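/- Let $(\mathscr A,\tau)$ be a $W^*$-noncommutative probability space, i.e. a von Neumann algebra with a faithful tracial state. Let $P\in\mathscr A$ be an orthogonal projection, $\theta=\tau(P)\in[0,1]$, and $S=2P-1$. Let $U\in\mathscr A$ be a Haar unitary (that is, $U$ is unitary and $\tau(U^k)=0$ for all $k\in\mathbb Z\setminus\{0\}$) which is $*$-free from $S$. Let $\mu_\infty$ be the spectral distribution of the unitary $SUSU^*$ in $(\mathscr A,\tau)$, i.e. the Borel probability measure on the unit circle $\mathbb T$ with $\int_{\mathbb T} f\,d\mu_\infty=\tau(f(SUSU^*))$ for all continuous $f$ on $\mathbb T$, and let $$H_\infty(z)=\int_{\mathbb T}\frac{w+z}{w-z}\,\mu_\infty(dw)$$ be its Herglotz transform. Put $\kappa=2\theta-1$. Then $\kappa=\tau(S)$, and $$H_\infty(z)=\sqrt{1+4\kappa^2\frac{z}{(1-z)^2}}$$ for all $z$ in some neighbourhood of the origin, with the principal branch of the square root. This equality extends analytically to the open unit disc: for $|z|<1$ the quantity $1+4\kappa^2 z/(1-z)^2$ never lies in $(-\infty,0]$, both sides are analytic on $\{|z|<1\}$, and they are equal there. -/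

import Mathlib

open MeasureTheory
open scoped ComplexOrder CompactlySupported

noncomputable section

namespace NCProb

/-- A faithful tracial state on a unital C*-algebra. If `A` is a von Neumann algebra
(`WStarAlgebra A`), then `(A, τ)` is a W*-noncommutative probability space. -/
structure FaithfulTracialState (A : Type*) [CStarAlgebra A] where
  /-- The underlying linear functional. -/
  toLinearMap : A →ₗ[ℂ] ℂ
  map_one' : toLinearMap 1 = 1
  nonneg' : ∀ a : A, 0 ≤ toLinearMap (star a * a)
  tracial' : ∀ a b : A, toLinearMap (a * b) = toLinearMap (b * a)
  faithful' : ∀ a : A, toLinearMap (star a * a) = 0 → a = 0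

instance (A : Type*) [CStarAlgebra A] : CoeFun (FaithfulTracialState A) (fun _ => A → ℂ) where
  coe τ := τ.toLinearMap

section

variable {A : Type*} [CStarAlgebra A]

/-- Voiculescu freeness of a family of unital *-subalgebras: every nonempty alternating product
of centred elements is centred. Each factor is recorded with the index of its subalgebra. -/
def IsFreeFamily (τ : FaithfulTracialState A) {ι : Type*} (B : ι → StarSubalgebra ℂ A) : Prop :=
  ∀ l : List (ι × A), l ≠ [] →
    l.IsChain (fun p q => p.1 ≠ q.1) →
    (∀ p ∈ l, p.2 ∈ B p.1 ∧ τ p.2 = 0) →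
    τ (l.map Prod.snd).prod = 0

/-- Two elements are *-free if the unital *-subalgebras that they generate are free. -/
def IsStarFree (τ : FaithfulTracialState A) (a b : A) : Prop :=
  IsFreeFamily τ (fun i : Bool => StarAlgebra.adjoin ℂ {bif i then a else b})

/-- A Haar unitary: `τ (U ^ k) = 0` for every nonzero integer `k`. -/
def IsHaarUnitary (τ : FaithfulTracialState A) (U : unitary A) : Prop :=
  ∀ k : ℤ, k ≠ 0 → τ ((U ^ k : unitary A) : A) = 0

/-- The symmetry `S = 2P - 1` attached to an orthogonal projection `P`, as a unitary. -/
def symmetryOf (P : A) (hP : IsStarProjection P) : unitary A :=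
  ⟨2 * P - 1, hP.two_mul_sub_one_mem_unitary⟩

/-- The inclusion of the spectrum of a unitary into the unit circle. -/
def spectrumToCircle (V : unitary A) :
    C(spectrum ℂ (V : A), Metric.sphere (0 : ℂ) 1) where
  toFun x := ⟨x.1, spectrum.subset_circle_of_unitary V.2 x.2⟩
  continuous_toFun := by fun_prop

/-- The continuous functional calculus `f ↦ f(V)` of a unitary `V`, for continuous functions
on the unit circle. -/
def circleCFC (V : unitary A) : C(Metric.sphere (0 : ℂ) 1, ℂ) →⋆ₐ[ℂ] A :=
  (cfcHom (R := ℂ) (a := (V : A)) (isStarNormal_of_mem_unitary V.2)).comp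
    (ContinuousMap.compStarAlgHom' ℂ ℂ (spectrumToCircle V))

/-- A real-valued function on the circle, seen as a complex-valued one. -/
def complexify (f : C_c(Metric.sphere (0 : ℂ) 1, ℝ)) : C(Metric.sphere (0 : ℂ) 1, ℂ) where
  toFun w := (f w : ℂ)

/-- The positive linear functional `f ↦ τ (f(V))` on real-valued continuous functions on the
circle. Its values are real, so that taking real parts loses nothing. -/
def circleFunctional (τ : FaithfulTracialState A) (V : unitary A) :
    C_c(Metric.sphere (0 : ℂ) 1, ℝ) →ₚ[ℝ] ℝ where
  toFun f := (τ (circleCFC V (complexify f))).re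
  map_add' f g := by
    have : complexify (f + g) = complexify f + complexify g := by
      ext w; simp [complexify]
    simp [this]
  map_smul' c f := by
    have : complexify (c • f) = (c : ℂ) • complexify f := by
      ext w; simp [complexify]
    rw [this, map_smul, map_smul]
    simp
  monotone' f g hfg := by
    let h : C(Metric.sphere (0 : ℂ) 1, ℂ) := ⟨fun w => (Real.sqrt (g w - f w) : ℂ), by fun_prop⟩
    have hh : complexify g = complexify f + star h * h := by
      ext w
      have h0 : 0 ≤ g w - f w := sub_nonneg.mpr (hfg w)
      have h1 : ((Real.sqrt (g w - f w) : ℂ)) * (Real.sqrt (g w - f w) : ℂ)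
          = (g w : ℂ) - f w := by
        rw [← Complex.ofReal_mul, Real.mul_self_sqrt h0]; push_cast; rfl
      simp [complexify, h, h1]
    have hpos := (Complex.le_def.mp (τ.nonneg' (circleCFC V h))).1
    simp only [hh, map_add, map_mul, map_star, Complex.add_re]
    simpa using hpos

/-- The spectral distribution of a unitary `V` in `(A, τ)`: the Borel measure on the unit circle
which represents the functional `f ↦ τ (f(V))`, by the Riesz-Markov-Kakutani theorem. -/
def spectralDistribution (τ : FaithfulTracialState A) (V : unitary A) :
    Measure (Metric.sphere (0 : ℂ) 1) :=
  RealRMK.rieszMeasure (circleFunctional τ V)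

/-- The Herglotz transform `z ↦ ∫ (w + z) / (w - z) μ(dw)` of a measure on the unit circle. -/
def herglotz (μ : Measure (Metric.sphere (0 : ℂ) 1)) (z : ℂ) : ℂ :=
  ∫ w, ((w : ℂ) + z) / ((w : ℂ) - z) ∂μ

end

end NCProb

end

namespace NCProb

/-! Put `a = S`, `b = U S U*`: two involutions of trace `k = κ`. Freeness enters only through `τ
(((a - k)(b - k))^n) = 0` for `n ≥ 1`, so `1 - z(a - k)(b - k)` has an inverse of trace `1` for
small `z`. Since `(a - k)(a + k) = 1 - k²`, multiplying this element by `1 - z(b + k)(a + k)` gives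
`E - z(ab + ba)` with a scalar `E` (`one_sub_smul_mul_one_sub_smul`). The inverse `R` of that
element commutes with `a` and `b`; traciality then gives a closed linear system for `τ R`, `τ (aR)`,
`τ (bR)`, `τ (abR)`, solved in `trace_resolvent`. The Herglotz transform at `ζ` is the trace of a
Cayley transform, hence `1 - ζ²` times the trace of the inverse of `(1 - ζba)(1 - ζab) = 1 + ζ² -
ζ(ab + ba)` (`trace_cayley`). This is a multiple of `E - z(ab + ba)` when `ζE = z(1 + ζ²)`;
eliminating `z` leaves the square root. Small positive real `ζ` suffice, by the identity theorem on
the disc. -/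

theorem commute_of_mul_eq_one {B : Type*} [Monoid B] {Q R x : B} (h : Q * R = 1) (h' : R * Q = 1)
    (hx : Commute Q x) : Commute R x := by
  calc R * x = R * (x * (Q * R)) := by rw [h, mul_one]
    _ = R * (Q * x) * R := by rw [hx.eq]; simp only [mul_assoc]
    _ = x * R := by rw [← mul_assoc R, h', one_mul]

/-! ### Resolvent identities for two involutions under a trace. -/

section Algebraic

variable {A : Type*} [Ring A] [Algebra ℂ A]

/-- The factorisation of a scalar plus a multiple of `a * b + b * a`, for involutions `a`, `b`. -/
theorem one_sub_smul_mul_one_sub_smul {a b : A} (ha : a * a = 1) (hb : b * b = 1) (k z : ℂ) :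
    (1 - z • ((a - k • 1) * (b - k • 1))) * (1 - z • ((b + k • 1) * (a + k • 1)))
      = (1 - 2 * z * k ^ 2 + z ^ 2 * (1 - k ^ 2) ^ 2) • (1 : A) - z • (a * b + b * a) := by
  have hb' : ∀ x, b * (b * x) = x := fun x => by rw [← mul_assoc, hb, one_mul]
  simp only [mul_add, add_mul, mul_sub, sub_mul, smul_mul_assoc, mul_smul_comm, one_mul, mul_one,
    mul_assoc, ha, hb, hb', smul_add, smul_sub]
  module

/-- The trace of the inverse `R` of `E - z (a b + b a)` for two involutions `a`, `b` with the same
trace. -/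
theorem trace_resolvent {τ : A →ₗ[ℂ] ℂ} (hτ : ∀ x y, τ (x * y) = τ (y * x)) (hτ1 : τ 1 = 1)
    {a b : A} (ha : a * a = 1) (hb : b * b = 1) {k z E : ℂ} (hka : τ a = k) (hkb : τ b = k)
    {R : A} (hRa : Commute R a) (hRb : Commute R b)
    (hQR : (E • (1 : A) - z • (a * b + b * a)) * R = 1)
    (hX : τ ((1 - z • ((b + k • 1) * (a + k • 1))) * R) = 1)
    (h1 : E + 2 * z ≠ 0) :
    τ R * (2 - E - 2 * z * k ^ 2) * (E - 2 * z) = E - 2 * z + 4 * z * k ^ 2 := by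
  have ha' : ∀ x, a * (a * x) = x := fun x => by rw [← mul_assoc, ha, one_mul]
  have hb' : ∀ x, b * (b * x) = x := fun x => by rw [← mul_assoc, hb, one_mul]
  have hba : τ (b * (a * R)) = τ (a * (b * R)) := by
    rw [hτ b, mul_assoc, hRb.eq]
  have haba : τ (a * (b * (a * R))) = τ (b * R) := by
    rw [hτ a, mul_assoc, mul_assoc, hRa.eq, ha']
  have hbab : τ (b * (a * (b * R))) = τ (a * R) := by
    rw [hτ b, mul_assoc, mul_assoc, hRb.eq, hb']
  -- The resolvent equation is tested against `1`, `a` and `b`.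
  have e0 := congrArg τ hQR
  have ea := congrArg (fun x => τ (a * x)) hQR
  have eb := congrArg (fun x => τ (b * x)) hQR
  simp only [mul_add, add_mul, mul_sub, sub_mul, smul_mul_assoc, mul_smul_comm, one_mul, mul_one,
    mul_assoc, ha', hb', smul_add, map_add, map_sub, map_smul, smul_eq_mul,
    hba, haba, hbab, hka, hkb, hτ1] at e0 ea eb hX
  have hgh : τ (a * R) = τ (b * R) := by
    have : (E + 2 * z) * (τ (a * R) - τ (b * R)) = 0 := by linear_combination ea - eb
    exact sub_eq_zero.mp ((mul_eq_zero.mp this).resolve_left h1)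
  rw [hgh] at ea hX
  -- `2 * hX - e0` cancels `τ (abR)`; `ea` then removes the remaining `τ (bR)`.
  linear_combination (E - 2 * z) * (2 * hX - e0) + 4 * z * k * ea

end Algebraic

/-! ### Positivity and continuity of a tracial state. -/

section Normed

variable {A : Type*} [CStarAlgebra A]

theorem FaithfulTracialState.nontrivial (τ : FaithfulTracialState A) : Nontrivial A := by
  refine ⟨1, 0, fun h => ?_⟩
  have := τ.map_one'
  rw [h, map_zero] at this
  exact zero_ne_one this

theorem FaithfulTracialState.im_eq_zero (τ : FaithfulTracialState A) {x : A}
    (hx : IsSelfAdjoint x) : (τ x).im = 0 := by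
  have h1 := (Complex.le_def.mp (τ.nonneg' (1 + x))).2
  have h2 := (Complex.le_def.mp (τ.nonneg' (1 - x))).2
  simp only [star_add, star_sub, star_one, hx.star_eq, mul_add, add_mul, mul_sub, sub_mul, one_mul,
    mul_one, map_add, map_sub, Complex.add_im, Complex.sub_im, Complex.zero_im] at h1 h2
  linarith

theorem FaithfulTracialState.star_mul_self_le (τ : FaithfulTracialState A) (x : A) :
    (τ (star x * x)).re ≤ ‖x‖ ^ 2 := by
  let := CStarAlgebra.spectralOrder A
  have := CStarAlgebra.spectralOrderedRing A
  have h : star x * x ≤ algebraMap ℝ A (‖x‖ ^ 2) := by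
    have := IsSelfAdjoint.le_algebraMap_norm_self (a := star x * x) (.star_mul_self x)
    rwa [CStarRing.norm_star_mul_self, ← sq] at this
  obtain ⟨y, hy⟩ := CStarAlgebra.nonneg_iff_eq_star_mul_self.mp (sub_nonneg.mpr h)
  have h2 := (Complex.le_def.mp (τ.nonneg' y)).1
  rw [← hy, map_sub, Algebra.algebraMap_eq_smul_one, ← Complex.coe_smul, map_smul, τ.map_one'] at h2
  simpa [← Complex.ofReal_pow] using h2

theorem FaithfulTracialState.map_star (τ : FaithfulTracialState A) (x : A) :
    τ (star x) = star (τ x) := by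
  have h1 := τ.im_eq_zero (IsSelfAdjoint.add_star_self x)
  have h2 := τ.im_eq_zero (x := Complex.I • (x - star x)) (by
    rw [IsSelfAdjoint, star_smul, star_sub, star_star, Complex.star_def, Complex.conj_I, neg_smul,
      ← smul_neg, neg_sub])
  rw [map_add, Complex.add_im] at h1
  simp only [map_smul, map_sub, smul_eq_mul, Complex.mul_im, Complex.I_re, Complex.I_im,
    Complex.sub_re, Complex.sub_im] at h2
  apply Complex.ext <;> simp <;> linarith

/-- The variance of `x` is nonnegative, so `|τ x|² ≤ τ (x* x) ≤ ‖x‖²`. Continuity of `τ` lets it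
pass through the Neumann series. -/
theorem FaithfulTracialState.norm_apply_le (τ : FaithfulTracialState A) (x : A) :
    ‖τ x‖ ≤ ‖x‖ := by
  have h := (Complex.le_def.mp (τ.nonneg' (x - (τ x) • 1))).1
  simp only [star_sub, star_smul, star_one, mul_sub, sub_mul, smul_mul_assoc, mul_smul_comm,
    one_mul, mul_one, map_sub, map_smul, τ.map_one', τ.map_star, smul_eq_mul] at h
  have h2 := τ.star_mul_self_le x
  have h3 : ‖τ x‖ ^ 2 = (τ x * star (τ x)).re := by
    rw [Complex.star_def, Complex.mul_conj, Complex.normSq_eq_norm_sq, Complex.ofReal_re]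
  refine (sq_le_sq₀ (norm_nonneg _) (norm_nonneg _)).mp ?_
  rw [h3]
  simp only [Complex.sub_re, Complex.mul_re, Complex.zero_re, Complex.star_def, Complex.conj_re,
    Complex.conj_im] at h h2 ⊢
  linarith

/-- A tracial state as a continuous linear functional. -/
noncomputable def FaithfulTracialState.toCLM (τ : FaithfulTracialState A) : A →L[ℂ] ℂ :=
  τ.toLinearMap.mkContinuous 1 fun x => by simpa using τ.norm_apply_le x

@[simp]
theorem FaithfulTracialState.toCLM_apply (τ : FaithfulTracialState A) (x : A) :
    τ.toCLM x = τ x := rfl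

theorem trace_eq_one_of_trace_pow_eq_zero (τ : FaithfulTracialState A) {x y : A} (hx : ‖x‖ < 1)
    (hτ : ∀ n : ℕ, n ≠ 0 → τ (x ^ n) = 0) (hy : (1 - x) * y = 1) : τ y = 1 := by
  have hs := summable_geometric_of_norm_lt_one hx
  have hyx : y = ∑' n : ℕ, x ^ n := by
    calc y = (∑' n : ℕ, x ^ n) * (1 - x) * y := by rw [geom_series_mul_neg x hx, one_mul]
      _ = _ := by rw [mul_assoc, hy, mul_one]
  rw [← τ.toCLM_apply, hyx, τ.toCLM.map_tsum hs, tsum_eq_single 0]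
  · simpa using τ.map_one'
  · exact hτ

end Normed

/-! ### Freeness of the conjugate, spectral distribution and Herglotz transform. -/

section SpectralDistribution

variable {A : Type*} [CStarAlgebra A]

/-- The power is the word `x u x u*` repeated `n` times: its letters are centred and alternate
between the two algebras, also where copies meet. -/
theorem IsStarFree.trace_conj_pow_eq_zero {τ : FaithfulTracialState A} {s u x : A}
    (h : IsStarFree τ s u) (hx : x ∈ StarAlgebra.adjoin ℂ {s}) (hτx : τ x = 0) (hu : τ u = 0)
    {n : ℕ} (hn : n ≠ 0) : τ ((x * (u * x * star u)) ^ n) = 0 := by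
  have hus : τ (star u) = 0 := by rw [τ.map_star, hu, star_zero]
  let l : List (Bool × A) := [(true, x), (false, u), (true, x), (false, star u)]
  have hl : ((List.replicate n l).flatten.map Prod.snd).prod = (x * (u * x * star u)) ^ n := by
    clear hn
    induction n with
    | zero => simp
    | succ n ih =>
      rw [List.replicate_succ, List.flatten_cons, List.map_append, List.prod_append, ih, pow_succ']
      simp [l, mul_assoc]
  rw [← hl]
  have hmem : u ∈ StarAlgebra.adjoin ℂ {u} := StarAlgebra.self_mem_adjoin_singleton ℂ u
  refine h _ ?_ ?_ ?_
  · simp [l, hn]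
  · rw [List.isChain_flatten (by simp [l])]
    refine ⟨by simp [l], ?_⟩
    exact List.isChain_replicate_of_rel _ (by simp [l])
  · intro p hp
    simp only [List.mem_flatten, List.mem_replicate] at hp
    obtain ⟨_, ⟨-, rfl⟩, hp⟩ := hp
    simp only [l, List.mem_cons, List.not_mem_nil, or_false] at hp
    rcases hp with rfl | rfl | rfl | rfl
    · exact ⟨hx, hτx⟩
    · exact ⟨hmem, hu⟩
    · exact ⟨hx, hτx⟩
    · exact ⟨star_mem hmem, hus⟩

theorem integral_spectralDistribution_complexify (τ : FaithfulTracialState A) (V : unitary A)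
    (f : C_c(Metric.sphere (0 : ℂ) 1, ℝ)) :
    ∫ w, complexify f w ∂spectralDistribution τ V = τ (circleCFC V (complexify f)) := by
  have h : τ (circleCFC V (complexify f)) = ((circleFunctional τ V f : ℝ) : ℂ) := by
    refine Complex.ext rfl ?_
    rw [Complex.ofReal_im]
    refine τ.im_eq_zero ?_
    rw [IsSelfAdjoint, ← map_star]
    congr 1
    ext w
    simp [complexify]
  rw [h, ← RealRMK.integral_rieszMeasure, ← integral_complex_ofReal]
  rfl

theorem integral_spectralDistribution (τ : FaithfulTracialState A) (V : unitary A)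
    (f : C(Metric.sphere (0 : ℂ) 1, ℂ)) :
    ∫ w, f w ∂spectralDistribution τ V = τ (circleCFC V f) := by
  have : IsFiniteMeasure (spectralDistribution τ V) := by
    unfold spectralDistribution; infer_instance
  let g : C_c(Metric.sphere (0 : ℂ) 1, ℝ) :=
    ⟨⟨fun w => (f w).re, by fun_prop⟩, HasCompactSupport.of_compactSpace _⟩
  let h : C_c(Metric.sphere (0 : ℂ) 1, ℝ) :=
    ⟨⟨fun w => (f w).im, by fun_prop⟩, HasCompactSupport.of_compactSpace _⟩
  have hf : f = complexify g + Complex.I • complexify h := by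
    ext w
    simp only [ContinuousMap.add_apply, ContinuousMap.smul_apply, smul_eq_mul, mul_comm Complex.I]
    exact (Complex.re_add_im (f w)).symm
  have hi : ∀ k : C(Metric.sphere (0 : ℂ) 1, ℂ), Integrable k (spectralDistribution τ V) :=
    fun k => k.continuous.integrable_of_hasCompactSupport (HasCompactSupport.of_compactSpace _)
  rw [hf, map_add, map_smul, map_add, map_smul, ← integral_spectralDistribution_complexify,
    ← integral_spectralDistribution_complexify, ← integral_smul,
    ← integral_add (hi _) ((hi _).fun_smul _)]
  rfl

theorem circleCFC_coe (V : unitary A) :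
    circleCFC V ⟨fun w => (w : ℂ), continuous_subtype_val⟩ = (V : A) :=
  cfcHom_id (R := ℂ) (a := (V : A)) (isStarNormal_of_mem_unitary V.2)

theorem isUnit_sub_smul (V : unitary A) {z : ℂ} (hz : ‖z‖ < 1) : IsUnit ((V : A) - z • 1) := by
  have h : z ∉ spectrum ℂ (V : A) := fun h => by
    have := spectrum.subset_circle_of_unitary V.2 h
    simp at this
    linarith
  rw [spectrum.notMem_iff, Algebra.algebraMap_eq_smul_one] at h
  simpa using h.neg

theorem herglotz_spectralDistribution (τ : FaithfulTracialState A) (V : unitary A) {z : ℂ}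
    (hz : ‖z‖ < 1) : herglotz (spectralDistribution τ V) z =
      τ (((V : A) + z • 1) * Ring.inverse ((V : A) - z • 1)) := by
  have hne : ∀ w : Metric.sphere (0 : ℂ) 1, (w : ℂ) - z ≠ 0 := fun w hw => by
    have : ‖(w : ℂ)‖ = 1 := by simp
    rw [sub_eq_zero.mp hw] at this
    linarith
  let f : C(Metric.sphere (0 : ℂ) 1, ℂ) :=
    ⟨fun w => ((w : ℂ) + z) / ((w : ℂ) - z), by fun_prop (disch := exact hne _)⟩
  let c : C(Metric.sphere (0 : ℂ) 1, ℂ) := ⟨fun w => (w : ℂ), continuous_subtype_val⟩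
  have hf : f * (c - z • 1) = c + z • 1 := by
    ext w
    simp [f, c, div_mul_cancel₀ _ (hne w)]
  have h := congrArg (circleCFC V) hf
  simp only [map_mul, map_sub, map_add, map_smul, map_one] at h
  rw [show circleCFC V c = (V : A) from circleCFC_coe V] at h
  rw [← h, mul_assoc, Ring.mul_inverse_cancel _ (isUnit_sub_smul V hz), mul_one,
    ← integral_spectralDistribution]
  rfl

/-- Analyticity comes from that of inversion in `A`, through the resolvent formula, not from
differentiating under the integral. -/
theorem analyticOnNhd_herglotz (τ : FaithfulTracialState A) (V : unitary A) :
    AnalyticOnNhd ℂ (herglotz (spectralDistribution τ V)) (Metric.ball 0 1) := by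
  intro z hz
  have hz' : ‖z‖ < 1 := by simpa using hz
  have h1 : AnalyticAt ℂ (fun z : ℂ => (V : A) - z • 1) z := by fun_prop
  have h2 : AnalyticAt ℂ (fun z : ℂ => (V : A) + z • 1) z := by fun_prop
  have h3 : AnalyticAt ℂ (Ring.inverse : A → A) ((V : A) - z • 1) :=
    analyticAt_inverse (isUnit_sub_smul V hz').unit
  have h4 := (τ.toCLM.analyticAt _).comp (h2.mul (AnalyticAt.fun_comp h3 h1))
  refine h4.congr ?_
  filter_upwards [Metric.isOpen_ball.mem_nhds hz] with w hw
  exact (herglotz_spectralDistribution τ V (by simpa using hw)).symm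

end SpectralDistribution

/-! ### The scalar function under the root and the change of variable. -/

section Scalar

theorem one_add_koebe_eq {k z : ℂ} (hz : 1 - z ≠ 0) :
    1 + 4 * k ^ 2 * (z / (1 - z) ^ 2) = (1 - k ^ 2) + k ^ 2 * ((1 + z) / (1 - z)) ^ 2 := by
  field_simp
  ring

theorem one_sub_ne_zero_of_norm_lt {z : ℂ} (hz : ‖z‖ < 1) : 1 - z ≠ 0 := fun h => by
  rw [← sub_eq_zero.mp h, norm_one] at hz
  exact lt_irrefl _ hz

theorem re_cayley_pos {z : ℂ} (hz : ‖z‖ < 1) : 0 < ((1 + z) / (1 - z)).re := by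
  have h0 := one_sub_ne_zero_of_norm_lt hz
  have h1 : 0 < Complex.normSq (1 - z) := Complex.normSq_pos.mpr h0
  have h2 : Complex.normSq z < 1 := by
    rw [Complex.normSq_eq_norm_sq]
    nlinarith [norm_nonneg z]
  rw [Complex.div_re, ← add_div]
  refine div_pos ?_ h1
  rw [Complex.normSq_apply] at h2
  simp only [Complex.add_re, Complex.sub_re, Complex.add_im, Complex.sub_im, Complex.one_re,
    Complex.one_im]
  nlinarith

theorem sq_mem_slitPlane_of_re_pos {w : ℂ} (hw : 0 < w.re) : w ^ 2 ∈ Complex.slitPlane := by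
  rw [Complex.mem_slitPlane_iff]
  by_cases h : w.im = 0
  · left
    simp [sq, h, hw.ne']
  · right
    rw [sq, Complex.mul_im, mul_comm w.im, ← two_mul]
    exact mul_ne_zero two_ne_zero (mul_ne_zero hw.ne' h)

/-- The value is a convex combination of `1` and the square of a number with positive real part; the
slit plane is star-shaped about `1`. -/
theorem one_add_koebe_mem_slitPlane {k : ℝ} (hk : k ^ 2 ≤ 1) {z : ℂ} (hz : ‖z‖ < 1) :
    1 + 4 * (k : ℂ) ^ 2 * (z / (1 - z) ^ 2) ∈ Complex.slitPlane := by
  rw [one_add_koebe_eq (one_sub_ne_zero_of_norm_lt hz)]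
  have := Complex.starConvex_one_slitPlane (sq_mem_slitPlane_of_re_pos (re_cayley_pos hz))
    (sub_nonneg.mpr hk) (sq_nonneg k) (by ring)
  simpa using this

theorem analyticOnNhd_sqrt_koebe {k : ℝ} (hk : k ^ 2 ≤ 1) :
    AnalyticOnNhd ℂ (fun z : ℂ => Complex.sqrt (1 + 4 * (k : ℂ) ^ 2 * (z / (1 - z) ^ 2)))
      (Metric.ball 0 1) := by
  intro z hz
  have hz' : ‖z‖ < 1 := by simpa using hz
  have h0 := pow_ne_zero 2 (one_sub_ne_zero_of_norm_lt hz')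
  unfold Complex.sqrt
  refine AnalyticAt.cpow ?_ analyticAt_const (one_add_koebe_mem_slitPlane hk hz')
  exact analyticAt_const.add (analyticAt_const.mul
    (analyticAt_id.div ((analyticAt_const.sub analyticAt_id).pow 2) h0))

/-- The substitution between the two generating variables. -/
theorem exists_substitution {k ζ : ℝ} (hk : k ^ 2 ≤ 1) (h0 : 0 < ζ) (h1 : ζ < 1 / 16) :
    ∃ z, 0 < z ∧ z < 2 * ζ ∧
      ζ * (1 - 2 * z * k ^ 2 + z ^ 2 * (1 - k ^ 2) ^ 2) = z * (1 + ζ ^ 2) := by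
  let f : ℝ → ℝ := fun z =>
    z * (1 + ζ ^ 2) - ζ * (1 - 2 * z * k ^ 2 + z ^ 2 * (1 - k ^ 2) ^ 2)
  have hf : ContinuousOn f (Set.Icc 0 (2 * ζ)) := by fun_prop
  have hD : (1 - k ^ 2) ^ 2 ≤ 1 := by nlinarith [sq_nonneg k]
  have h2 : ζ ^ 2 * (1 - k ^ 2) ^ 2 ≤ ζ ^ 2 := mul_le_of_le_one_right (sq_nonneg ζ) hD
  have hmem : (0 : ℝ) ∈ Set.Ioo (f 0) (f (2 * ζ)) := by
    constructor
    · simp [f, h0]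
    · have : f (2 * ζ) = ζ * (1 + 2 * ζ ^ 2 + 4 * ζ * k ^ 2 - 4 * (ζ ^ 2 * (1 - k ^ 2) ^ 2)) := by
        simp only [f]; ring
      rw [this]
      refine mul_pos h0 ?_
      nlinarith [mul_nonneg h0.le (sq_nonneg k)]
  obtain ⟨z, hz, hfz⟩ := intermediate_value_Ioo (by linarith) hf hmem
  exact ⟨z, hz.1, hz.2, by simp only [f] at hfz; linarith⟩

/-- Elimination of the auxiliary variable `z`. -/
theorem eq_sqrt_of_substitution {k ζ z J : ℝ} (hk : k ^ 2 ≤ 1) (h0 : 0 < ζ) (h1 : ζ < 1)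
    (hz0 : 0 < z) (hz1 : z < 1)
    (hz : ζ * (1 - 2 * z * k ^ 2 + z ^ 2 * (1 - k ^ 2) ^ 2) = z * (1 + ζ ^ 2))
    (hJ : J * (1 - z ^ 2 * (1 - k ^ 2) ^ 2) *
      (1 - 2 * z * k ^ 2 + z ^ 2 * (1 - k ^ 2) ^ 2 - 2 * z) = (1 - z * (1 - k ^ 2)) ^ 2) :
    (1 - ζ ^ 2) * (z / ζ) * J = √(1 + 4 * k ^ 2 * (ζ / (1 - ζ) ^ 2)) := by
  have hζ : 0 < 1 - ζ := by linarith
  have hp : 0 < 1 - z * (1 - k ^ 2) := by nlinarith [sq_nonneg k]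
  have hq : 0 < 1 + z * (1 - k ^ 2) := by nlinarith [sq_nonneg k]
  -- The substitution reads `E = z(1 + ζ²)/ζ`, so `E ∓ 2z = z(1 ∓ ζ)²/ζ`; moreover `E + 2z` is the
  -- square `(1 + z(1 - k²))²`.
  have hE : 1 - 2 * z * k ^ 2 + z ^ 2 * (1 - k ^ 2) ^ 2 - 2 * z = z * (1 - ζ) ^ 2 / ζ := by
    field_simp
    linear_combination hz
  have hJ' : (1 - ζ ^ 2) * (z / ζ) * J
      = (1 + ζ) * (1 - z * (1 - k ^ 2)) / ((1 + z * (1 - k ^ 2)) * (1 - ζ)) := by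
    have hfac : 1 - z ^ 2 * (1 - k ^ 2) ^ 2 =
      (1 - z * (1 - k ^ 2)) * (1 + z * (1 - k ^ 2)) := by ring
    rw [hE, hfac] at hJ
    have : J = (1 - z * (1 - k ^ 2)) * ζ / ((1 + z * (1 - k ^ 2)) * (z * (1 - ζ) ^ 2)) := by
      rw [eq_div_iff (by positivity)]
      field_simp at hJ
      linear_combination hJ
    rw [this]
    field_simp
    ring
  rw [hJ']
  symm
  rw [Real.sqrt_eq_iff_mul_self_eq_of_pos (by positivity)]
  have hq2 : (1 + z * (1 - k ^ 2)) ^ 2 = z * (1 + ζ) ^ 2 / ζ := by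
    field_simp
    linear_combination hz
  rw [← sq, div_pow, mul_pow, mul_pow, hq2]
  field_simp
  linear_combination hz

end Scalar

/-! ### The Herglotz transform for small positive reals, then on the disc. -/

section Resolvent

variable {A : Type*} [CStarAlgebra A]

/-- The trace of a Cayley transform of the product of two involutions `a`, `b`. -/
theorem trace_cayley (τ : FaithfulTracialState A) {a b : A} (ha : a * a = 1) (hb : b * b = 1)
    {ζ : ℂ} {R : A} (hRb : Commute R b)
    (hu : IsUnit (a * b - ζ • 1))
    (hR : (1 - ζ • (b * a)) * (1 - ζ • (a * b)) * R = 1) :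
    τ ((a * b + ζ • 1) * Ring.inverse (a * b - ζ • 1)) = (1 - ζ ^ 2) * τ R := by
  have ha' : ∀ x, a * (a * x) = x := fun x => by rw [← mul_assoc, ha, one_mul]
  have hb' : ∀ x, b * (b * x) = x := fun x => by rw [← mul_assoc, hb, one_mul]
  have h1 : (a * b - ζ • 1) * (b * a * (1 - ζ • (a * b)) * R) = 1 := by
    refine Eq.trans ?_ hR
    simp only [mul_sub, sub_mul, smul_mul_assoc, mul_smul_comm, one_mul, mul_one,
      mul_assoc, ha', hb', smul_sub]
  have h2 : Ring.inverse (a * b - ζ • 1) = b * a * (1 - ζ • (a * b)) * R := by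
    rw [← Ring.inverse_mul_cancel_left _ (b * a * (1 - ζ • (a * b)) * R) hu, h1, mul_one]
  -- Beyond `(1 - ζ²)R` only the difference of `baR` and `abR` survives, and it has trace zero.
  have h3 : (a * b + ζ • 1) * (b * a * (1 - ζ • (a * b)) * R)
      = (1 - ζ ^ 2) • R + ζ • (b * (a * R)) - ζ • (a * (b * R)) := by
    simp only [add_mul, mul_sub, sub_mul, smul_mul_assoc, mul_smul_comm, one_mul, mul_one,
      mul_assoc, ha', hb']
    module
  have h4 : τ (b * (a * R)) = τ (a * (b * R)) := by
    rw [τ.tracial' b, mul_assoc, hRb.eq]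
  rw [h2, h3]
  simp [h4]

/-- The variance of `a` is `1 - k²`. -/
theorem sq_trace_le_one (τ : FaithfulTracialState A) {a : A} (ha : a * a = 1) (hs : star a = a)
    {k : ℝ} (hk : τ a = k) : k ^ 2 ≤ 1 := by
  have h := (Complex.le_def.mp (τ.nonneg' (a - (k : ℂ) • 1))).1
  simp only [star_sub, star_smul, star_one, mul_sub, sub_mul, smul_mul_assoc, mul_smul_comm,
    one_mul, mul_one, map_sub, map_smul, τ.map_one', smul_eq_mul, hs, ha, hk] at h
  simp at h
  nlinarith

/-- The Herglotz transform at a small positive real, for the product of two involutions whose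
centred parts satisfy the freeness relations `τ (((a - k) * (b - k)) ^ n) = 0`. -/
theorem herglotz_eq_sqrt_of_pos (τ : FaithfulTracialState A) (V : unitary A) {a b : A}
    (hV : (V : A) = a * b) (ha : a * a = 1) (hb : b * b = 1) (hsa : star a = a) (hsb : star b = b)
    {k : ℝ} (hka : τ a = k) (hkb : τ b = k)
    (hfree : ∀ n : ℕ, n ≠ 0 → τ (((a - (k : ℂ) • 1) * (b - (k : ℂ) • 1)) ^ n) = 0)
    {ζ : ℝ} (h0 : 0 < ζ) (h1 : ζ < 1 / 16) :
    herglotz (spectralDistribution τ V) ζ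
      = Complex.sqrt (1 + 4 * (k : ℂ) ^ 2 * ((ζ : ℂ) / (1 - ζ) ^ 2)) := by
  have := τ.nontrivial
  have hk := sq_trace_le_one τ ha hsa hka
  obtain ⟨z, hz0, hz1, hz⟩ := exists_substitution hk h0 h1
  have hζn : ‖(ζ : ℂ)‖ < 1 := by
    rw [Complex.norm_real, Real.norm_of_nonneg h0.le]; linarith
  have hbaV : b * a = (star V : unitary A) := by simp [hV, hsa, hsb]
  have hM : IsUnit (1 - (ζ : ℂ) • (a * b)) := by
    refine isUnit_one_sub_of_norm_lt_one ?_
    rwa [← hV, norm_smul, CStarRing.norm_coe_unitary, mul_one]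
  have hN : IsUnit (1 - (ζ : ℂ) • (b * a)) := by
    refine isUnit_one_sub_of_norm_lt_one ?_
    rwa [hbaV, norm_smul, CStarRing.norm_coe_unitary, mul_one]
  set R := Ring.inverse ((1 - (ζ : ℂ) • (b * a)) * (1 - (ζ : ℂ) • (a * b))) with hRdef
  have hR := Ring.mul_inverse_cancel _ (hN.mul hM)
  have hR' := Ring.inverse_mul_cancel _ (hN.mul hM)
  rw [← hRdef] at hR hR'
  have hprod : (1 - (ζ : ℂ) • (b * a)) * (1 - (ζ : ℂ) • (a * b))
      = (1 + (ζ : ℂ) ^ 2) • (1 : A) - (ζ : ℂ) • (a * b + b * a) := by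
    have ha' : ∀ x, a * (a * x) = x := fun x => by rw [← mul_assoc, ha, one_mul]
    simp only [mul_sub, sub_mul, smul_mul_assoc, mul_smul_comm, one_mul, mul_one,
      mul_assoc, ha', hb]
    module
  have hca : Commute ((1 - (ζ : ℂ) • (b * a)) * (1 - (ζ : ℂ) • (a * b))) a := by
    rw [hprod, Commute, SemiconjBy]
    simp only [mul_sub, sub_mul, mul_add, add_mul, smul_mul_assoc, mul_smul_comm, one_mul, mul_one,
      mul_assoc, ha]
    simp only [← mul_assoc, ha, one_mul, add_comm]
  have hcb : Commute ((1 - (ζ : ℂ) • (b * a)) * (1 - (ζ : ℂ) • (a * b))) b := by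
    rw [hprod, Commute, SemiconjBy]
    simp only [mul_sub, sub_mul, mul_add, add_mul, smul_mul_assoc, mul_smul_comm, one_mul, mul_one,
      mul_assoc, hb]
    simp only [← mul_assoc, hb, one_mul, add_comm]
  have hRa := commute_of_mul_eq_one hR hR' hca
  have hRb := commute_of_mul_eq_one hR hR' hcb
  have hζ0 : (ζ : ℂ) ≠ 0 := by exact_mod_cast h0.ne'
  have hzc0 : (z : ℂ) ≠ 0 := by exact_mod_cast hz0.ne'
  have hzc : (ζ : ℂ) * (1 - 2 * z * (k : ℂ) ^ 2 + (z : ℂ) ^ 2 * (1 - (k : ℂ) ^ 2) ^ 2)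
      = z * (1 + (ζ : ℂ) ^ 2) := by exact_mod_cast hz
  set E : ℂ := 1 - 2 * z * (k : ℂ) ^ 2 + (z : ℂ) ^ 2 * (1 - (k : ℂ) ^ 2) ^ 2 with hE
  have hQ : E • (1 : A) - (z : ℂ) • (a * b + b * a)
      = ((z : ℂ) / ζ) • ((1 - (ζ : ℂ) • (b * a)) * (1 - (ζ : ℂ) • (a * b))) := by
    have : E = (z : ℂ) / ζ * (1 + (ζ : ℂ) ^ 2) := by field_simp; linear_combination hzc
    rw [hprod, smul_sub, smul_smul, smul_smul, this, div_mul_cancel₀ _ hζ0]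
  set T : A := ((ζ : ℂ) / z) • R with hT
  have hQT : (E • (1 : A) - (z : ℂ) • (a * b + b * a)) * T = 1 := by
    rw [hQ, hT, smul_mul_smul_comm, hR, div_mul_div_cancel₀ hζ0, div_self hzc0, one_smul]
  -- By the factorisation this element inverts `1 - z(a - k)(b - k)`. The Neumann series converges:
  -- both factors have norm at most `2`, and `z < 2ζ < 1/8`.
  have hX : τ ((1 - (z : ℂ) • ((b + (k : ℂ) • 1) * (a + (k : ℂ) • 1))) * T) = 1 := by
    refine trace_eq_one_of_trace_pow_eq_zero τ
      (x := (z : ℂ) • ((a - (k : ℂ) • 1) * (b - (k : ℂ) • 1))) ?_ ?_ ?_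
    · have hnorm : ∀ x : A, x * x = 1 → star x = x → ‖x - (k : ℂ) • 1‖ ≤ 2 := by
        intro x hx hsx
        have hx1 : ‖x‖ = 1 :=
          CStarRing.norm_of_mem_unitary (Unitary.mem_iff.mpr ⟨by rw [hsx, hx], by rw [hsx, hx]⟩)
        have hk1 : |k| ≤ 1 := by rwa [← sq_le_one_iff_abs_le_one]
        calc ‖x - (k : ℂ) • 1‖ ≤ ‖x‖ + ‖(k : ℂ) • (1 : A)‖ := norm_sub_le _ _
          _ = 1 + |k| := by rw [hx1, norm_smul, norm_one, mul_one, Complex.norm_real,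
              Real.norm_eq_abs]
          _ ≤ 2 := by linarith
      calc ‖(z : ℂ) • ((a - (k : ℂ) • 1) * (b - (k : ℂ) • 1))‖
          ≤ z * (‖a - (k : ℂ) • 1‖ * ‖b - (k : ℂ) • 1‖) := by
            rw [norm_smul, Complex.norm_real, Real.norm_of_nonneg hz0.le]
            gcongr
            exact norm_mul_le _ _
        _ ≤ z * (2 * 2) := by
            gcongr
            · exact hnorm a ha hsa
            · exact hnorm b hb hsb
        _ < 1 := by linarith
    · intro n hn
      rw [smul_pow, map_smul, hfree n hn, smul_zero]
    · rw [← mul_assoc, one_sub_smul_mul_one_sub_smul ha hb]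
      exact hQT
  have hE2 : E + 2 * z ≠ 0 := by
    have : E + 2 * z = (((1 + z * (1 - k ^ 2)) ^ 2 : ℝ) : ℂ) := by
      rw [hE]; push_cast; ring
    rw [this, Complex.ofReal_ne_zero]
    have : 0 ≤ z * (1 - k ^ 2) := mul_nonneg hz0.le (by linarith)
    positivity
  have hJ := trace_resolvent τ.tracial' τ.map_one' ha hb hka hkb (hRa.smul_left _)
    (hRb.smul_left _) hQT hX hE2
  have hTim : (τ T).im = 0 := by
    refine τ.im_eq_zero ?_
    have hs : star ((1 - (ζ : ℂ) • (b * a)) * (1 - (ζ : ℂ) • (a * b)))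
        = (1 - (ζ : ℂ) • (b * a)) * (1 - (ζ : ℂ) • (a * b)) := by
      simp [hsa, hsb]
    have hsR : star R = R := by
      have h := congrArg star hR'
      rw [star_mul, hs, star_one] at h
      calc star R = R * (((1 - (ζ : ℂ) • (b * a)) * (1 - (ζ : ℂ) • (a * b))) * star R) := by
            rw [← mul_assoc, hR', one_mul]
        _ = R := by rw [h, mul_one]
    rw [IsSelfAdjoint, hT, star_smul, hsR]
    simp
  obtain ⟨J, hJr⟩ : ∃ J : ℝ, τ T = J := ⟨(τ T).re, Complex.ext rfl (by simpa using hTim)⟩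
  have hu : IsUnit (a * b - (ζ : ℂ) • 1) := hV ▸ isUnit_sub_smul V hζn
  have hRT : τ R = z / ζ * τ T := by
    rw [hT, map_smul, smul_eq_mul]
    field_simp
  rw [herglotz_spectralDistribution τ V hζn, hV, trace_cayley τ ha hb hRb hu hR, hRT, hJr,
    show (1 + 4 * (k : ℂ) ^ 2 * ((ζ : ℂ) / (1 - ζ) ^ 2))
      = ((1 + 4 * k ^ 2 * (ζ / (1 - ζ) ^ 2) : ℝ) : ℂ) by push_cast; rfl,
    Complex.sqrt_of_nonneg (by rw [Complex.zero_le_real]; positivity), Complex.ofReal_re,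
    ← eq_sqrt_of_substitution (J := J) hk h0 (by linarith) hz0 (by linarith) hz]
  · push_cast; ring
  · rw [hJr, hE] at hJ
    have : J * (2 - (1 - 2 * z * k ^ 2 + z ^ 2 * (1 - k ^ 2) ^ 2) - 2 * z * k ^ 2) *
        (1 - 2 * z * k ^ 2 + z ^ 2 * (1 - k ^ 2) ^ 2 - 2 * z)
        = 1 - 2 * z * k ^ 2 + z ^ 2 * (1 - k ^ 2) ^ 2 - 2 * z + 4 * z * k ^ 2 := by
      exact_mod_cast hJ
    linear_combination this

/-- The Herglotz transform on the whole disc, by analytic continuation. -/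
theorem herglotz_eqOn_sqrt (τ : FaithfulTracialState A) (V : unitary A) {k : ℝ} (hk : k ^ 2 ≤ 1)
    (h : ∀ ζ : ℝ, 0 < ζ → ζ < 1 / 16 → herglotz (spectralDistribution τ V) ζ
      = Complex.sqrt (1 + 4 * (k : ℂ) ^ 2 * ((ζ : ℂ) / (1 - ζ) ^ 2))) :
    Set.EqOn (herglotz (spectralDistribution τ V))
      (fun z : ℂ => Complex.sqrt (1 + 4 * (k : ℂ) ^ 2 * (z / (1 - z) ^ 2)))
      (Metric.ball 0 1) := by
  refine (analyticOnNhd_herglotz τ V).eqOn_of_preconnected_of_mem_closure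
    (analyticOnNhd_sqrt_koebe hk) (convex_ball 0 1).isPreconnected (z₀ := 0) (by simp) ?_
  rw [Metric.mem_closure_iff]
  intro ε hε
  -- The identity theorem needs `0` to be an accumulation point of the coincidence set; `1/32` keeps
  -- the point below `1/16`.
  have hpos : 0 < min (ε / 2) (1 / 32) := by positivity
  refine ⟨(min (ε / 2) (1 / 32) : ℝ), ⟨?_, ?_⟩, ?_⟩
  · exact h _ hpos ((min_le_right _ _).trans_lt (by norm_num))
  · simpa using hpos.ne'
  · rw [dist_zero_left, Complex.norm_real, Real.norm_of_nonneg hpos.le]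
    exact (min_le_left _ _).trans_lt (by linarith)

end Resolvent

end NCProb

theorem mainTheorem6 {A : Type*} [CStarAlgebra A] [WStarAlgebra A]
    (τ : NCProb.FaithfulTracialState A)
    (P : A) (hP : IsStarProjection P)
    (U : unitary A) (hU : NCProb.IsHaarUnitary τ U)
    (S : unitary A) (hS : S = NCProb.symmetryOf P hP)
    (hfree : NCProb.IsStarFree τ (S : A) (U : A))
    (θ κ : ℝ) (hθ : τ P = (θ : ℂ)) (hκ : κ = 2 * θ - 1)
    (H : ℂ → ℂ)
    (hH : H = NCProb.herglotz (NCProb.spectralDistribution τ (S * U * S * star U))) :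
    τ (S : A) = (κ : ℂ) ∧
    (∀ᶠ z in nhds (0 : ℂ),
      H z = Complex.sqrt (1 + 4 * (κ : ℂ) ^ 2 * (z / (1 - z) ^ 2))) ∧
    (∀ z ∈ Metric.ball (0 : ℂ) 1,
      1 + 4 * (κ : ℂ) ^ 2 * (z / (1 - z) ^ 2) ∈ Complex.slitPlane) ∧
    AnalyticOnNhd ℂ (fun z : ℂ => Complex.sqrt (1 + 4 * (κ : ℂ) ^ 2 * (z / (1 - z) ^ 2)))
      (Metric.ball 0 1) ∧
    AnalyticOnNhd ℂ H (Metric.ball 0 1) ∧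
    (∀ z ∈ Metric.ball (0 : ℂ) 1,
      H z = Complex.sqrt (1 + 4 * (κ : ℂ) ^ 2 * (z / (1 - z) ^ 2))) := by
  have hSP : (S : A) = 2 * P - 1 := by rw [hS]; rfl
  have hsS : star (S : A) = S := by
    rw [hSP, star_sub, star_mul, hP.isSelfAdjoint.star_eq, star_one, star_ofNat, mul_two, two_mul]
  have hSS : (S : A) * S = 1 := by
    nth_rewrite 1 [← hsS]
    exact Unitary.coe_star_mul_self S
  have hτS : τ (S : A) = κ := by
    rw [hSP, hκ, two_mul, map_sub, map_add, hθ, τ.map_one']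
    push_cast
    ring
  have hUU : star (U : A) * U = 1 := Unitary.coe_star_mul_self U
  have hUU' : (U : A) * star (U : A) = 1 := Unitary.coe_mul_star_self U
  have hk : κ ^ 2 ≤ 1 := NCProb.sq_trace_le_one τ hSS hsS hτS
  have hτU : τ (U : A) = 0 := by simpa using hU 1 one_ne_zero
  have hx : (S : A) - (κ : ℂ) • 1 ∈ StarAlgebra.adjoin ℂ {(S : A)} :=
    sub_mem (StarAlgebra.self_mem_adjoin_singleton ℂ _)
      (SMulMemClass.smul_mem _ (one_mem _))
  have hτx : τ ((S : A) - (κ : ℂ) • 1) = 0 := by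
    rw [map_sub, map_smul, hτS, τ.map_one', smul_eq_mul, mul_one, sub_self]
  have hconj : (U : A) * S * star (U : A) - (κ : ℂ) • 1
      = U * ((S : A) - (κ : ℂ) • 1) * star (U : A) := by
    rw [mul_sub, sub_mul, mul_smul_comm, mul_one, smul_mul_assoc, hUU']
  have heq := NCProb.herglotz_eqOn_sqrt τ (S * U * S * star U) hk fun ζ h0 h1 =>
    NCProb.herglotz_eq_sqrt_of_pos τ (S * U * S * star U) (a := S) (b := U * S * star (U : A))
      (by simp [mul_assoc]) hSS
      (by
        rw [mul_assoc, ← mul_assoc (star (U : A)), ← mul_assoc (star (U : A)), hUU, one_mul,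
          mul_assoc, ← mul_assoc (S : A), hSS, one_mul, hUU'])
      hsS (by simp [hsS, mul_assoc]) hτS
      (by rw [τ.tracial', ← mul_assoc, hUU, one_mul, hτS])
      (fun n hn => by
        rw [hconj]
        exact hfree.trace_conj_pow_eq_zero hx hτx hτU hn)
      h0 h1
  rw [← hH] at heq
  refine ⟨hτS, ?_, fun z hz => NCProb.one_add_koebe_mem_slitPlane hk (by simpa using hz),
    NCProb.analyticOnNhd_sqrt_koebe hk, ?_, heq⟩
  · filter_upwards [Metric.ball_mem_nhds (0 : ℂ) one_pos] with z hz using heq hz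
  · rw [hH]
    exact NCProb.analyticOnNhd_herglotz τ _
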